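/- Let $\Bbbk$ be a field, let $R_n=\Bbbk[x_1,\dots,x_n]$ for $n\ge 1$, and let $\mathcal I=(I_n)_{n\ge 1}$ be a chain in which every $I_n\subseteq R_n$ is the edge ideal $I_n=\langle x_ix_j \mid \{i,j\}\in E(G_n)\rangle$ of a simple graph $G_n$ on the vertex set $\{1,\dots,n\}$, with $I_n\neq 0$ for all sufficiently large $n$. For $n\ge m\ge 1$ let $\mathrm{Inc}_{m,n}$ be the set of strictly increasing maps $\pi:\mathbb N\to\mathbb N$ of the positive integers with $\pi(m)\le n$, acting by $\pi(x_i)=x_{\pi(i)}$, and let $\langle \mathrm{Inc}_{m,n}(I_m)\rangle_{R_n}$ be the ideal of $R_n$ generated by all $\pi(f)$ with $\pi\in\mathrm{Inc}_{m,n}$ and $f\in I_m$. Assume that $\mathcal I$ is $\mathrm{Inc}$-invariant, that is, $\langle \mathrm{Inc}_{m,n}(I_m)\rangle_{R_n}\subseteq I_n$ for all $n\ge m\ge 1$. Let $r=\mathrm{ind}(\mathcal I)$ be the stability index, i.e. the least $r\ge 1$ such that $\langle \mathrm{Inc}_{m,n}(I_m)\rangle_{R_n}= I_n$ for all $n\ge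 m\ge r$ (such an $r$ always exists, and then $I_r\ne 0$). Put $\widetilde r=p-i_1+1$, where $i_1$ and $p$ are the smallest and the largest index $i$ such that $x_i$ divides some minimal monomial generator of $I_r$, and let $\mathrm{sp}(\mathcal I)=\min\{j-i\mid i<j,\ \{i,j\}\in E(G_r)\}$ be the sparsity index of $\mathcal I$. If $\mathrm{sp}(\mathcal I)\le 2$, then $$\operatorname{depth}(R_n/I_n)=r-\widetilde r+\mathrm{sp}(\mathcal I)\qquad\text{for all } n\ge r+2\widetilde r,$$ where $\operatorname{depth}(R_n/I_n)$ is the maximal length of an $R_n/I_n$-regular sequence of elements of the graded maximal ideal $\langle x_1,\dots,x_n\rangle$ of $R_n$. -/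

import Mathlib

/-!
Conventions. The polynomial ring `R_n = K[x_1, …, x_n]` is `MvPolynomial (Fin n) K`; the variable
`x_i` (`1 ≤ i ≤ n`) is `X` of the element `i - 1` of `Fin n`, and likewise the vertex `i` of a graph
on `{1, …, n}` is the element `i - 1` of `Fin n`. A chain of ideals `(I_n)_{n ≥ 1}` is a function
defined on all natural numbers whose value at `0` is never looked at.
-/

namespace IncChain

open MvPolynomial

noncomputable section

/-- The edge ideal of a simple graph on `{1, …, n}`, generated by all `x_i x_j` with `{i, j}` an
edge. -/
def edgeIdeal (K : Type*) [Field K] {n : ℕ} (G : SimpleGraph (Fin n)) :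
    Ideal (MvPolynomial (Fin n) K) :=
  Ideal.span {f | ∃ i j : Fin n, G.Adj i j ∧ f = X i * X j}

/-- `Inc_{m,n}`: the strictly increasing maps `π` of the positive integers with `π(m) ≤ n`.
With the positive integers numbered from `0`, the condition says that `π` maps every index below `m`
to an index below `n`. -/
def Inc (m n : ℕ) : Set (ℕ → ℕ) :=
  {π | StrictMono π ∧ ∀ i, i < m → π i < n}

/-- The action of `π ∈ Inc_{m,n}` on `R_m`, with values in `R_n`: the `K`-algebra map sending
`x_i` to `x_{π(i)}`. -/
def act (K : Type*) [Field K] {m n : ℕ} {π : ℕ → ℕ} (hπ : π ∈ Inc m n) :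
    MvPolynomial (Fin m) K →ₐ[K] MvPolynomial (Fin n) K :=
  rename fun i : Fin m => (⟨π i, hπ.2 i i.isLt⟩ : Fin n)

/-- `⟨Inc_{m,n}(J)⟩_{R_n}`: the ideal of `R_n` generated by the images `π(f)` of the elements `f`
of the ideal `J` of `R_m` under all `π ∈ Inc_{m,n}`. -/
def incSpan {K : Type*} [Field K] {m : ℕ} (J : Ideal (MvPolynomial (Fin m) K)) (n : ℕ) :
    Ideal (MvPolynomial (Fin n) K) :=
  Ideal.span {g | ∃ (π : ℕ → ℕ) (hπ : π ∈ Inc m n), ∃ f ∈ J, g = act K hπ f}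

/-- The chain `(I_n)_{n ≥ 1}` is `Inc`-invariant. -/
def IsInvariant {K : Type*} [Field K] (I : (n : ℕ) → Ideal (MvPolynomial (Fin n) K)) : Prop :=
  ∀ m n : ℕ, 1 ≤ m → m ≤ n → incSpan (I m) n ≤ I n

/-- The stability index `ind(𝓘)`: the least `r ≥ 1` such that `⟨Inc_{m,n}(I_m)⟩ = I_n` for all
`n ≥ m ≥ r`. -/
def stabilityIndex {K : Type*} [Field K] (I : (n : ℕ) → Ideal (MvPolynomial (Fin n) K)) : ℕ :=
  sInf {r | 1 ≤ r ∧ ∀ m n : ℕ, r ≤ m → m ≤ n → incSpan (I m) n = I n}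

/-- The exponent vectors of the minimal monomial generators of a monomial ideal `J`: the monomials
of `J` that are minimal with respect to divisibility. -/
def minGens {K : Type*} [Field K] {n : ℕ} (J : Ideal (MvPolynomial (Fin n) K)) :
    Set (Fin n →₀ ℕ) :=
  {a | Minimal (fun b : Fin n →₀ ℕ => monomial b (1 : K) ∈ J) a}

/-- The set of (`1`-based) indices `i` such that `x_i` divides some minimal monomial generator
of `J`. -/
def supportIndices {K : Type*} [Field K] {n : ℕ} (J : Ideal (MvPolynomial (Fin n) K)) : Set ℕ :=
  {k | ∃ i : Fin n, k = (i : ℕ) + 1 ∧ ∃ a ∈ minGens J, a i ≠ 0}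

/-- The smallest index of a variable in the support of a (nonzero) monomial ideal. -/
def minSupp {K : Type*} [Field K] {n : ℕ} (J : Ideal (MvPolynomial (Fin n) K)) : ℕ :=
  sInf (supportIndices J)

/-- The largest index of a variable in the support of a (nonzero) monomial ideal. -/
def maxSupp {K : Type*} [Field K] {n : ℕ} (J : Ideal (MvPolynomial (Fin n) K)) : ℕ :=
  sSup (supportIndices J)

/-- The number `r̃ = max supp(I_r) - min supp(I_r) + 1` with `r = ind(𝓘)`. When `I_r ≠ 0` one has
`1 ≤ min supp(I_r) ≤ max supp(I_r) ≤ r`, so that the subtraction is the usual one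
and `1 ≤ r̃ ≤ r`. -/
def rTilde {K : Type*} [Field K] (I : (n : ℕ) → Ideal (MvPolynomial (Fin n) K)) : ℕ :=
  maxSupp (I (stabilityIndex I)) - minSupp (I (stabilityIndex I)) + 1

/-- The sparsity index `min {j - i | {i, j} an edge, i < j}` of (the edge ideal of) a graph on
`{1, …, n}` with at least one edge. -/
def sparsity {n : ℕ} (G : SimpleGraph (Fin n)) : ℕ :=
  sInf {d | ∃ i j : Fin n, i < j ∧ G.Adj i j ∧ d = (j : ℕ) - (i : ℕ)}

/-- The depth of an `R`-module `M` with respect to an ideal `𝔞`: the supremum of the lengths of the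
`M`-regular sequences consisting of elements of `𝔞`. -/
def depth {R : Type*} [CommRing R] (𝔞 : Ideal R) (M : Type*) [AddCommGroup M] [Module R M] : ℕ∞ :=
  sSup {d | ∃ rs : List R, (∀ x ∈ rs, x ∈ 𝔞) ∧ RingTheory.Sequence.IsRegular M rs ∧
    d = (rs.length : ℕ∞)}

/-- The graded maximal ideal `⟨x_1, …, x_n⟩` of `R_n`. -/
def irrelevant (K : Type*) [Field K] (n : ℕ) : Ideal (MvPolynomial (Fin n) K) :=
  Ideal.span (Set.range X)

end

end IncChain

/-! For `n ≥ r` the graph of `I_n` consists of the images of the edges of `G_r`. By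
`isEdge_incGraph_iff`, a pair is such an image exactly when its left, middle and right gaps are all
at least those of some edge of `G_r`. Hence, with `s` and `e` the extreme endpoints of edges of
`G_r`, the `r - r̃` vertices outside `[s, n + e - r]` are isolated, and their variables form a
regular sequence. The rest of the depth comes from the interval.

If the sparsity is 1, some vertex `v` of the interval is adjacent to all its other vertices. If it
is 2, consecutive vertices are never adjacent, and every other vertex of the interval is adjacent to
`v` or `v + 1`. So the isolated vertices together with `v`, or with `v` and `v + 1`, form a maximal
independent set. It gives an associated prime whose quotient has dimension `r - r̃ + sp`, which
bounds the depth from above (`length_le_ringKrullDim_quotient`, `depth_le_card`).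

For the lower bound, append to the isolated variables the sum of all variables and, for sparsity 2,
the second elementary symmetric polynomial. The latter is regular because the path of consecutive
vertices makes the independence complex of the interval connected
(`mem_sup_span_of_sumPairs_mul_mem`). -/

/-! ### Regular sequences and the dimension of associated primes -/

-- Nakayama's lemma at `𝔪` without localizing. Otherwise a product `U ∉ 𝔪` of multipliers of
-- generators maps `M` into `xM`, and Cayley–Hamilton gives a monic `p`, with lower coefficients in
-- `(x)`, such that `p(U)` kills `M`; then a power of `U` lies in `𝔪`.
open Polynomial Pointwise in
theorem Submodule.exists_notMem_smul_not_mem_smul_top {R M : Type*} [CommRing R] [AddCommGroup M]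
    [Module R M] [Module.Finite R M] (𝔪 : Ideal R) [𝔪.IsPrime] {x : R} (hx : x ∈ 𝔪)
    (hM : ∀ u : R, (∀ m : M, u • m = 0) → u ∈ 𝔪) :
    ∃ m : M, ∀ u : R, u • m ∈ x • (⊤ : Submodule R M) → u ∈ 𝔪 := by
  by_contra! hcon
  choose u hu hu' using hcon
  obtain ⟨S, hS⟩ := (Module.Finite.fg_top : (⊤ : Submodule R M).FG)
  set U : R := ∏ s ∈ S, u s with hU
  have hUm : U ∉ 𝔪 := by
    rw [hU, Ideal.IsPrime.prod_mem_iff]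
    rintro ⟨s, -, hs⟩
    exact hu' s hs
  have hUM : ∀ m : M, U • m ∈ x • (⊤ : Submodule R M) := by
    have : (⊤ : Submodule R M) ≤
        (x • (⊤ : Submodule R M)).comap (algebraMap R (Module.End R M) U) := by
      rw [← hS, Submodule.span_le]
      intro s hs
      rw [SetLike.mem_coe, Submodule.mem_comap, Module.algebraMap_end_apply, hU, hS]
      obtain ⟨c, hc⟩ := Finset.dvd_prod_of_mem u hs
      rw [hc, mul_comm, mul_smul]
      exact Submodule.smul_mem _ _ (hu s)
    intro m
    exact this (Submodule.mem_top (x := m))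
  obtain ⟨p, hp, -, hpc, hp0⟩ :=
    LinearMap.exists_monic_and_natDegree_eq_and_coeff_mem_pow_and_aeval_eq_zero R
      (algebraMap R (Module.End R M) U) (Ideal.span {x}) (by
        rintro _ ⟨m, rfl⟩
        rw [Submodule.ideal_span_singleton_smul]
        exact hUM m)
  rw [Polynomial.aeval_algebraMap_apply] at hp0
  have hmem : p.eval U ∈ 𝔪 := hM _ fun m ↦ by
    have := LinearMap.congr_fun hp0 m
    simpa using this
  rw [Polynomial.eval_eq_sum_range, Finset.sum_range_succ, hp.coeff_natDegree, one_mul] at hmem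
  refine hUm (‹𝔪.IsPrime›.mem_of_pow_mem p.natDegree ((Ideal.add_mem_iff_right _ ?_).mp hmem))
  refine Ideal.sum_mem _ fun k hk ↦ Ideal.mul_mem_right _ _ ?_
  have h1 := hpc k
  have h2 : p.natDegree - k ≠ 0 := by
    have := Finset.mem_range.mp hk
    omega
  exact (Ideal.span_singleton_le_iff_mem 𝔪).mpr hx (Ideal.pow_le_self h2 h1)

open Pointwise in
/-- A weakly regular sequence in a prime ideal is no longer than the dimension of the quotient by
an associated prime contained in that ideal. -/
theorem RingTheory.Sequence.IsWeaklyRegular.length_le_ringKrullDim_quotient {R : Type*}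
    [CommRing R] [IsNoetherianRing R] (𝔪 : Ideal R) [𝔪.IsPrime] (rs : List R) {M : Type*}
    [AddCommGroup M] [Module R M] [Module.Finite R M] (hrs : IsWeaklyRegular M rs)
    (hmem : ∀ x ∈ rs, x ∈ 𝔪) (P : Ideal R) [P.IsPrime] (hP : P ≤ 𝔪) (z : M)
    (hz : ∀ a : R, a ∈ P ↔ a • z = 0) :
    (rs.length : WithBot ℕ∞) ≤ ringKrullDim (R ⧸ P) := by
  induction rs generalizing M P with
  | nil => simpa using ringKrullDim_nonneg_of_nontrivial
  | cons x rs ih =>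
    rw [isWeaklyRegular_cons_iff] at hrs
    obtain ⟨hreg, hrs⟩ := hrs
    have hxm : x ∈ 𝔪 := hmem x (by simp)
    -- The inductive step replaces `P` by a strictly larger associated prime `Q` of `M/xM`. Working
    -- in the part of `M` killed by `P` ensures `P ≤ Q`.
    set N : Submodule R M := Submodule.torsionBySet R M (P : Set R) with hN
    have hzN : z ∈ N := by
      rw [hN, Submodule.mem_torsionBySet_iff]
      rintro ⟨a, ha⟩
      exact (hz a).mp ha
    obtain ⟨m, hm⟩ := Submodule.exists_notMem_smul_not_mem_smul_top (M := N) 𝔪 hxm (by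
      intro u hu
      refine hP ((hz u).mpr ?_)
      simpa using congrArg Subtype.val (hu ⟨z, hzN⟩))
    set w : QuotSMulTop x M := Submodule.Quotient.mk (m : M) with hw
    have hcol : (⊥ : Submodule R (QuotSMulTop x M)).colon {w} ≤ 𝔪 := by
      intro u hu
      rw [Submodule.mem_colon_singleton, Submodule.mem_bot, hw, ← Submodule.Quotient.mk_smul,
        Submodule.Quotient.mk_eq_zero, Submodule.mem_smul_pointwise_iff_exists] at hu
      obtain ⟨y, -, hy⟩ := hu
      -- Regularity of `x` gives `xM ∩ N = xN`, so the choice of `m` modulo `xN` also controls its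
      -- class modulo `xM`.
      have hyN : y ∈ N := by
        rw [hN, Submodule.mem_torsionBySet_iff]
        rintro ⟨a, ha⟩
        apply hreg
        have h1 : a • (m : M) = 0 := (Submodule.mem_torsionBySet_iff _ _).mp m.2 ⟨a, ha⟩
        change x • (a • y) = x • (0 : M)
        rw [smul_comm, hy, smul_comm, h1, smul_zero, smul_zero]
      refine hm u ?_
      rw [Submodule.mem_smul_pointwise_iff_exists]
      exact ⟨⟨y, hyN⟩, trivial, Subtype.ext hy⟩
    obtain ⟨Q, hQ, hQm⟩ := Ideal.exists_minimalPrimes_le hcol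
    have hQp : Q.IsPrime := hQ.1.1
    obtain ⟨w', hw'⟩ := Submodule.exists_eq_colon_of_mem_minimalPrimes hQ
    have hlen := ih hrs (fun y hy ↦ hmem y (by simp [hy])) Q hQm w' (by
      intro a
      rw [hw', Submodule.mem_colon_singleton, Submodule.mem_bot])
    have hPQ : P ≤ Q := by
      refine le_trans ?_ hQ.1.2
      intro a ha
      have h1 : a • (m : M) = 0 := (Submodule.mem_torsionBySet_iff _ _).mp m.2 ⟨a, ha⟩
      rw [Submodule.mem_colon_singleton, Submodule.mem_bot, hw, ← Submodule.Quotient.mk_smul, h1,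
        Submodule.Quotient.mk_zero]
    have hxQ : x ∈ Q := by
      refine hQ.1.2 ?_
      rw [Submodule.mem_colon_singleton, Submodule.mem_bot, hw, ← Submodule.Quotient.mk_smul,
        Submodule.Quotient.mk_eq_zero]
      exact Submodule.smul_mem_pointwise_smul _ _ _ Submodule.mem_top
    have hxP : x ∉ P := by
      intro hxP
      have h0 : z = 0 := hreg (by simpa using (hz x).mp hxP)
      exact ‹P.IsPrime›.ne_top ((Ideal.eq_top_iff_one P).mpr ((hz 1).mpr (by simp [h0])))
    refine le_trans ?_ (ringKrullDim_succ_le_of_surjective (Ideal.Quotient.factor hPQ)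
      (Ideal.Quotient.factor_surjective hPQ) (r := Ideal.Quotient.mk P x) ?_ ?_)
    · simpa using add_le_add_left hlen 1
    · rw [mem_nonZeroDivisors_iff_ne_zero, Ne, Ideal.Quotient.eq_zero_iff_mem]
      exact hxP
    · rw [Ideal.Quotient.factor_mk, Ideal.Quotient.eq_zero_iff_mem]
      exact hxQ

/-! ### Stanley–Reisner ideals via restriction to faces -/

namespace MvPolynomial

section FaceIdeal

variable {K : Type*} [Field K] {V : Type*} [DecidableEq V]

/-- The endomorphism of the polynomial ring that kills the variables outside `F`. -/
noncomputable def faceMap (K : Type*) [Field K] (F : Finset V) :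
    MvPolynomial V K →ₐ[K] MvPolynomial V K :=
  aeval fun v ↦ if v ∈ F then X v else 0

theorem faceMap_X (F : Finset V) (v : V) :
    faceMap K F (X v) = if v ∈ F then X v else 0 := by
  simp [faceMap]

theorem faceMap_monomial (F : Finset V) (m : V →₀ ℕ) (a : K) :
    faceMap K F (monomial m a) = if m.support ⊆ F then monomial m a else 0 := by
  rw [faceMap, aeval_monomial]
  split_ifs with h
  · rw [monomial_eq, Finsupp.prod, Finsupp.prod, algebraMap_eq]
    congr 1
    refine Finset.prod_congr rfl fun v hv ↦ ?_
    rw [if_pos (h hv)]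
  · obtain ⟨v, hv, hvF⟩ := Finset.not_subset.mp h
    rw [Finsupp.prod, Finset.prod_eq_zero hv, mul_zero]
    rw [if_neg hvF, zero_pow (Finsupp.mem_support_iff.mp hv)]

theorem coeff_faceMap (F : Finset V) (f : MvPolynomial V K) (m : V →₀ ℕ) :
    coeff m (faceMap K F f) = if m.support ⊆ F then coeff m f else 0 := by
  classical
  induction f using MvPolynomial.induction_on' with
  | monomial d a =>
    rw [faceMap_monomial]
    by_cases hd : d = m
    · subst hd
      split_ifs <;> simp
    · split_ifs <;> simp [coeff_monomial, hd]
  | add p q hp hq =>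
    rw [map_add, coeff_add, coeff_add, hp, hq]
    split_ifs <;> simp

theorem faceMap_faceMap {F F' : Finset V} (h : F' ⊆ F) (f : MvPolynomial V K) :
    faceMap K F' (faceMap K F f) = faceMap K F' f := by
  ext m
  rw [coeff_faceMap, coeff_faceMap, coeff_faceMap]
  split_ifs with h1 h2
  · rfl
  · exact absurd (h1.trans h) h2
  · rfl

theorem faceMap_empty (f : MvPolynomial V K) :
    faceMap K (∅ : Finset V) f = C (constantCoeff f) := by
  ext m
  rw [coeff_faceMap, coeff_C]
  by_cases hm : m = 0
  · simp [hm, constantCoeff_eq]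
  · rw [if_neg (by simpa using hm), if_neg (Ne.symm hm)]

theorem constantCoeff_faceMap (F : Finset V) (f : MvPolynomial V K) :
    constantCoeff (faceMap K F f) = constantCoeff f := by
  rw [constantCoeff_eq, coeff_faceMap, if_pos (by simp)]

/-- The Stanley–Reisner ideal of a family of faces: the polynomials whose restriction to each face
vanishes. -/
noncomputable def faceIdeal (K : Type*) [Field K] (Δ : Set (Finset V)) :
    Ideal (MvPolynomial V K) :=
  ⨅ F ∈ Δ, RingHom.ker (faceMap K F)

theorem mem_faceIdeal {Δ : Set (Finset V)} {f : MvPolynomial V K} :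
    f ∈ faceIdeal K Δ ↔ ∀ F ∈ Δ, faceMap K F f = 0 := by
  simp [faceIdeal, Submodule.mem_iInf, RingHom.mem_ker]

/-- A cone point can be added to any face, and there its variable is nonzero in a domain. -/
theorem mem_faceIdeal_of_X_mul_mem {Δ : Set (Finset V)} {v : V}
    (hv : ∀ F ∈ Δ, insert v F ∈ Δ) {f : MvPolynomial V K} (hf : X v * f ∈ faceIdeal K Δ) :
    f ∈ faceIdeal K Δ := by
  rw [mem_faceIdeal] at hf ⊢
  intro F hF
  have h := hf _ (hv F hF)
  rw [map_mul, faceMap_X, if_pos (Finset.mem_insert_self v F), mul_eq_zero,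
    or_iff_right (X_ne_zero v)] at h
  rw [← faceMap_faceMap (Finset.subset_insert v F), h, map_zero]

/-- Compatible polynomials on the faces come from a global polynomial. -/
theorem exists_faceMap_eq [Fintype V] {Δ : Set (Finset V)} (h : Finset V → MvPolynomial V K)
    (hh : ∀ F ∈ Δ, ∀ F' ⊆ F, faceMap K F' (h F) = faceMap K F' (h F')) :
    ∃ g : MvPolynomial V K, ∀ F ∈ Δ, faceMap K F g = faceMap K F (h F) := by
  classical
  -- The coefficient of each monomial is read off on the smallest face carrying it, its support.
  let g : MvPolynomial V K :=
    ∑ F : Finset V, ∑ m ∈ (h F).support.filter (fun m ↦ m.support = F), monomial m (coeff m (h F))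
  have hg : ∀ m, coeff m g = coeff m (h m.support) := by
    intro m
    simp only [g, coeff_sum, coeff_monomial]
    rw [Finset.sum_eq_single m.support]
    · rw [Finset.sum_ite_eq']
      split_ifs with hm
      · rfl
      · simpa using Eq.symm (by simpa using hm)
    · intro F _ hF
      refine Finset.sum_eq_zero fun d hd ↦ if_neg ?_
      rintro rfl
      exact hF (Finset.mem_filter.mp hd).2.symm
    · simp
  refine ⟨g, fun F hF ↦ ?_⟩
  ext m
  rw [coeff_faceMap, coeff_faceMap]
  split_ifs with hm
  · have := congrArg (coeff m) (hh F hF _ hm)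
    rw [coeff_faceMap, coeff_faceMap, if_pos subset_rfl, if_pos subset_rfl] at this
    rw [hg, this]
  · rfl

theorem faceMap_sum_X [Fintype V] (F : Finset V) :
    faceMap K F (∑ v, X v) = ∑ v ∈ F, X v := by
  simp [faceMap_X]

theorem prime_sum_X {F : Finset V} (hF : F.Nonempty) :
    Prime (∑ v ∈ F, X v : MvPolynomial V K) := by
  obtain ⟨u, hu⟩ := hF
  have hc : coeff (Finsupp.single u 1) (∑ v ∈ F, X v : MvPolynomial V K) = 1 := by
    simp [coeff_sum, coeff_X, Finsupp.single_left_inj, hu]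
  have h0 : (∑ v ∈ F, X v : MvPolynomial V K) ≠ 0 := by
    intro h
    simp [h] at hc
  refine Irreducible.prime (irreducible_of_totalDegree_eq_one ?_ ?_)
  · exact (IsHomogeneous.sum F _ 1 fun v _ ↦ isHomogeneous_X K v).totalDegree h0
  · intro x hx
    have := hx (Finsupp.single u 1)
    rw [hc] at this
    exact isUnit_of_dvd_one this

theorem mem_faceIdeal_of_sum_X_mul_mem [Fintype V] {Δ : Set (Finset V)}
    (hne : ∀ F ∈ Δ, ∃ F' ∈ Δ, F ⊆ F' ∧ F'.Nonempty) {f : MvPolynomial V K}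
    (hf : (∑ v, X v) * f ∈ faceIdeal K Δ) : f ∈ faceIdeal K Δ := by
  rw [mem_faceIdeal] at hf ⊢
  intro F hF
  obtain ⟨F', hF', hFF', hne'⟩ := hne F hF
  have h := hf F' hF'
  rw [map_mul, faceMap_sum_X, mul_eq_zero, or_iff_right (prime_sum_X hne').ne_zero] at h
  rw [← faceMap_faceMap hFF', h, map_zero]

/-- The second elementary symmetric polynomial. -/
noncomputable def sumPairs (K V : Type*) [Field K] [Fintype V] [LinearOrder V] :
    MvPolynomial V K :=
  ∑ p : V × V with p.1 < p.2, X p.1 * X p.2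

end FaceIdeal

/-! ### Regularity of the second elementary symmetric polynomial -/

section Quadric

variable {K : Type*} [Field K] {V : Type*} [Fintype V] [LinearOrder V]

theorem not_sum_X_dvd_faceMap_sumPairs {F : Finset V} (hF : 1 < F.card) :
    ¬ (∑ v ∈ F, X v) ∣ faceMap K F (sumPairs K V) := by
  obtain ⟨a, ha, b, hb, hab⟩ := Finset.one_lt_card.mp hF
  wlog hlt : a < b generalizing a b
  · exact this b hb a ha hab.symm (lt_of_le_of_ne (not_lt.mp hlt) hab.symm)
  -- At this point the linear form vanishes while the quadric takes the value `-1`.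
  let y : V → K := fun v ↦ if v = a then 1 else if v = b then -1 else 0
  intro hdvd
  have hy := map_dvd (aeval y) hdvd
  have h1 : aeval y (∑ v ∈ F, X v : MvPolynomial V K) = 0 := by
    rw [map_sum, ← Finset.add_sum_erase _ _ ha,
      ← Finset.add_sum_erase _ _ (Finset.mem_erase.mpr ⟨hab.symm, hb⟩), Finset.sum_eq_zero]
    · simp [y, hab.symm]
    · intro v hv
      simp only [Finset.mem_erase] at hv
      simp [y, hv.1, hv.2.1]
  have h2 : aeval y (faceMap K F (sumPairs K V)) = (-1 : K) := by
    rw [sumPairs, map_sum, map_sum, Finset.sum_eq_single (a, b)]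
    · simp [faceMap_X, ha, hb, y, hab.symm]
    · rintro ⟨u, v⟩ huv hne
      have huv' : u < v := by simpa using huv
      rw [map_mul, map_mul, faceMap_X, faceMap_X]
      by_cases hua : u = a
      · subst hua
        have : v ≠ b := fun h ↦ hne (by rw [h])
        split_ifs <;> simp [y, this, huv'.ne']
      · by_cases hub : u = b
        · subst hub
          have h3 : v ≠ a := (hlt.trans huv').ne'
          split_ifs <;> simp [y, h3, huv'.ne']
        · split_ifs <;> simp [y, hua, hub]
    · simp [hlt]
  rw [h1, h2, zero_dvd_iff] at hy
  exact one_ne_zero (neg_eq_zero.mp hy)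

/-- On a connected complex without isolated vertices, the first two elementary symmetric
polynomials form a regular sequence. -/
theorem mem_sup_span_of_sumPairs_mul_mem {Δ : Set (Finset V)}
    (hdown : ∀ F ∈ Δ, ∀ F' ⊆ F, F' ∈ Δ)
    (hpair : ∀ F ∈ Δ, ∃ F' ∈ Δ, F ⊆ F' ∧ 1 < F'.card)
    (hconn : ∀ c : V → K, (∀ u v, {u, v} ∈ Δ → c u = c v) →
      ∀ u v, {u} ∈ Δ → {v} ∈ Δ → c u = c v)
    {f : MvPolynomial V K}
    (hf : sumPairs K V * f ∈ faceIdeal K Δ ⊔ Ideal.span {∑ v, X v}) :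
    f ∈ faceIdeal K Δ ⊔ Ideal.span {∑ v, X v} := by
  obtain ⟨j, hj, t, ht, hjt⟩ := Submodule.mem_sup.mp hf
  obtain ⟨g, rfl⟩ := Ideal.mem_span_singleton'.mp ht
  rw [mem_faceIdeal] at hj
  -- On a face with two vertices or more the linear form is prime and does not divide the quadric,
  -- so it divides `f`. Smaller faces inherit the quotient from a larger one.
  have hloc : ∀ F ∈ Δ, ∃ k : MvPolynomial V K,
      faceMap K F f = (∑ v ∈ F, X v) * faceMap K F k := by
    intro F hF
    obtain ⟨F', hF', hFF', hcard⟩ := hpair F hF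
    have hne : F'.Nonempty := Finset.card_pos.mp (by omega)
    have h1 := congrArg (faceMap K F') hjt
    rw [map_add, hj F' hF', zero_add, map_mul, map_mul, faceMap_sum_X] at h1
    obtain ⟨k, hk⟩ := ((prime_sum_X hne).dvd_or_dvd (Dvd.intro_left _ h1)).resolve_left
      (not_sum_X_dvd_faceMap_sumPairs hcard)
    refine ⟨k, ?_⟩
    rw [← faceMap_faceMap hFF', hk, map_mul, ← faceMap_sum_X F', faceMap_faceMap hFF',
      faceMap_sum_X]
  choose! k hk using hloc
  have hcompat : ∀ F ∈ Δ, ∀ F' ⊆ F, F'.Nonempty → faceMap K F' (k F) = faceMap K F' (k F') := by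
    intro F hF F' hFF' hne
    have h1 := congrArg (faceMap K F') (hk F hF)
    rw [faceMap_faceMap hFF', hk F' (hdown F hF F' hFF'), map_mul, ← faceMap_sum_X F,
      faceMap_faceMap hFF', faceMap_faceMap hFF', faceMap_sum_X] at h1
    exact (mul_left_cancel₀ (prime_sum_X hne).ne_zero h1).symm
  have hvert : ∀ F ∈ Δ, ∀ u ∈ F, constantCoeff (k F) = constantCoeff (k {u}) := by
    intro F hF u hu
    have := congrArg constantCoeff
      (hcompat F hF {u} (Finset.singleton_subset_iff.mpr hu) (Finset.singleton_nonempty u))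
    rwa [constantCoeff_faceMap, constantCoeff_faceMap] at this
  -- The quotients agree on nonempty overlaps by cancellation. On the empty face the linear form is
  -- zero, so only connectedness forces the constant terms to agree.
  have hconst : ∀ u v, {u} ∈ Δ → {v} ∈ Δ → constantCoeff (k {u}) = constantCoeff (k {v}) :=
    hconn _ fun u v huv ↦
      (hvert _ huv u (by simp)).symm.trans (hvert _ huv v (by simp))
  by_cases hΔ : ∃ u, {u} ∈ Δ
  · obtain ⟨u₀, hu₀⟩ := hΔ
    -- The quotient chosen on the empty face is arbitrary and is replaced by one with the common
    -- constant term.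
    obtain ⟨h, hh⟩ := exists_faceMap_eq (Δ := Δ) (fun F ↦ if F = ∅ then k {u₀} else k F) (by
      intro F hF F' hFF'
      rcases F'.eq_empty_or_nonempty with rfl | hne
      · rcases F.eq_empty_or_nonempty with rfl | hneF
        · rfl
        · obtain ⟨u, hu⟩ := hneF
          have huΔ : {u} ∈ Δ := hdown F hF _ (Finset.singleton_subset_iff.mpr hu)
          rw [if_pos rfl, if_neg (Finset.ne_empty_of_mem hu), faceMap_empty, faceMap_empty,
            hvert F hF u hu, hconst u u₀ huΔ hu₀]
      · have hneF : F.Nonempty := hne.mono hFF'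
        rw [if_neg hne.ne_empty, if_neg hneF.ne_empty, hcompat F hF F' hFF' hne])
    have hmem : f - h * ∑ v, X v ∈ faceIdeal K Δ := by
      rw [mem_faceIdeal]
      intro F hF
      rw [map_sub, map_mul, faceMap_sum_X, hh F hF, hk F hF]
      rcases F.eq_empty_or_nonempty with rfl | hne
      · simp
      · rw [if_neg hne.ne_empty, mul_comm, sub_self]
    rw [← sub_add_cancel f (h * ∑ v, X v)]
    exact Submodule.add_mem_sup hmem (Ideal.mem_span_singleton'.mpr ⟨h, rfl⟩)
  · refine Submodule.mem_sup_left (mem_faceIdeal.mpr fun F hF ↦ ?_)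
    obtain ⟨F', hF', -, hcard⟩ := hpair F hF
    obtain ⟨u, hu⟩ := Finset.card_pos.mp (zero_lt_one.trans hcard)
    exact absurd ⟨u, hdown F' hF' _ (Finset.singleton_subset_iff.mpr hu)⟩ hΔ

end Quadric

/-! ### Primes of facets -/

section Facet

variable {K : Type*} [Field K] {V : Type*} [DecidableEq V]

/-- The prime ideal of a facet is the annihilator of the monomial of the facet. -/
theorem mul_prod_X_mem_faceIdeal_iff {Δ : Set (Finset V)} {F : Finset V} (hF : F ∈ Δ)
    (hmax : ∀ F' ∈ Δ, F ⊆ F' → F' = F) (f : MvPolynomial V K) :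
    f * ∏ v ∈ F, X v ∈ faceIdeal K Δ ↔ faceMap K F f = 0 := by
  rw [mem_faceIdeal]
  constructor
  · intro h
    have h1 := h F hF
    rw [map_mul, mul_eq_zero] at h1
    refine h1.resolve_right ?_
    rw [map_prod, ← Ne, Finset.prod_ne_zero_iff]
    intro v hv
    rw [faceMap_X, if_pos hv]
    exact X_ne_zero v
  · intro h F' hF'
    by_cases hsub : F ⊆ F'
    · rw [hmax F' hF' hsub, map_mul, h, zero_mul]
    · obtain ⟨v, hv, hvF'⟩ := Finset.not_subset.mp hsub
      rw [map_mul, map_prod, Finset.prod_eq_zero hv, mul_zero]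
      rw [faceMap_X, if_neg hvF']

theorem isPrime_ker_faceMap (F : Finset V) : (RingHom.ker (faceMap K F)).IsPrime :=
  RingHom.ker_isPrime _

theorem ringKrullDim_quotient_ker_faceMap [Finite V] (F : Finset V) :
    ringKrullDim (MvPolynomial V K ⧸ RingHom.ker (faceMap K F)) = F.card := by
  let φ : MvPolynomial V K →ₐ[K] MvPolynomial F K :=
    aeval fun v ↦ if h : v ∈ F then X ⟨v, h⟩ else 0
  have hcomp : (rename (Subtype.val : F → V)).comp φ = faceMap K F := by
    refine algHom_ext fun v ↦ ?_
    rw [faceMap_X]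
    by_cases hv : v ∈ F <;> simp [φ, hv]
  have hsurj : Function.Surjective φ := by
    have hid : φ.comp (rename (Subtype.val : F → V)) = AlgHom.id K _ :=
      algHom_ext fun v ↦ by simp [φ]
    exact fun p ↦ ⟨rename Subtype.val p, DFunLike.congr_fun hid p⟩
  have hker : RingHom.ker (faceMap K F) = RingHom.ker φ := by
    ext p
    rw [RingHom.mem_ker, RingHom.mem_ker, ← hcomp, AlgHom.comp_apply,
      map_eq_zero_iff _ (rename_injective _ Subtype.val_injective)]
  rw [hker, ringKrullDim_eq_of_ringEquiv
      (Ideal.quotientKerAlgEquivOfSurjective hsurj).toRingEquiv,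
    ringKrullDim_of_isNoetherianRing, ringKrullDim_eq_zero_of_field, zero_add, Nat.card_eq_fintype_card,
    Fintype.card_coe]

end Facet

end MvPolynomial

/-! ### Regular sequences on a quotient ring -/

theorem Submodule.mem_ideal_smul_top_quotient_iff {R : Type*} [CommRing R] (I J : Ideal R) (f : R) :
    (Submodule.Quotient.mk f : R ⧸ I) ∈ (J • ⊤ : Submodule R (R ⧸ I)) ↔ f ∈ I ⊔ J := by
  have h : (J • ⊤ : Submodule R (R ⧸ I)) = Submodule.map (Submodule.mkQ I) J := by
    rw [← Submodule.range_mkQ I, ← Submodule.map_top, ← Submodule.map_smul'', smul_eq_mul,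
      Ideal.mul_top]
  rw [h, ← Submodule.mkQ_apply, ← Submodule.mem_comap, Submodule.comap_map_mkQ]

namespace RingTheory.Sequence

theorem IsWeaklyRegular.append_singleton {R : Type*} [CommRing R] {I : Ideal R} {rs : List R}
    (h : IsWeaklyRegular (R ⧸ I) rs) {r : R}
    (hr : ∀ f, r * f ∈ I ⊔ Ideal.ofList rs → f ∈ I ⊔ Ideal.ofList rs) :
    IsWeaklyRegular (R ⧸ I) (rs ++ [r]) := by
  rw [isWeaklyRegular_append_iff, isWeaklyRegular_singleton_iff]
  refine ⟨h, ?_⟩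
  refine isSMulRegular_iff_right_eq_zero_of_smul.mpr fun x hx ↦ ?_
  obtain ⟨y, rfl⟩ := Submodule.Quotient.mk_surjective _ x
  obtain ⟨f, rfl⟩ := Submodule.Quotient.mk_surjective _ y
  rw [← Submodule.Quotient.mk_smul, ← Submodule.Quotient.mk_smul, Submodule.Quotient.mk_eq_zero,
    Submodule.mem_ideal_smul_top_quotient_iff] at hx
  rw [Submodule.Quotient.mk_eq_zero, Submodule.mem_ideal_smul_top_quotient_iff]
  exact hr f hx

theorem IsWeaklyRegular.isRegular_quotient {R : Type*} [CommRing R] {I 𝔪 : Ideal R}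
    {rs : List R} (h : IsWeaklyRegular (R ⧸ I) rs) (hI : I ≤ 𝔪) (hrs : ∀ x ∈ rs, x ∈ 𝔪)
    (h𝔪 : 𝔪 ≠ ⊤) : IsRegular (R ⧸ I) rs := by
  refine ⟨h, fun htop ↦ h𝔪 ?_⟩
  have h1 : (Submodule.Quotient.mk (1 : R) : R ⧸ I) ∈ (⊤ : Submodule R (R ⧸ I)) := trivial
  rw [htop, Submodule.mem_ideal_smul_top_quotient_iff] at h1
  exact (Ideal.eq_top_iff_one _).mpr (sup_le hI (Ideal.span_le.mpr hrs) h1)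

end RingTheory.Sequence

/-! ### Depth of edge ideals -/

namespace IncChain

open MvPolynomial RingTheory.Sequence

section Depth

variable {K : Type*} [Field K] {n : ℕ}

/-- The independent sets of a graph that avoid a given set of vertices. -/
def indepFaces {V : Type*} (G : SimpleGraph V) (A : Set V) : Set (Finset V) :=
  {F | (∀ u ∈ F, ∀ v ∈ F, ¬ G.Adj u v) ∧ ∀ u ∈ F, u ∉ A}

theorem indepFaces_mono {V : Type*} (G : SimpleGraph V) (A : Set V) {F F' : Finset V}
    (hF : F ∈ indepFaces G A) (h : F' ⊆ F) : F' ∈ indepFaces G A :=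
  ⟨fun u hu v hv ↦ hF.1 u (h hu) v (h hv), fun u hu ↦ hF.2 u (h hu)⟩

theorem X_mul_X_dvd_monomial {V : Type*} {u v : V} (huv : u ≠ v) {m : V →₀ ℕ} (hu : m u ≠ 0)
    (hv : m v ≠ 0) (a : K) : (X u * X v : MvPolynomial V K) ∣ monomial m a := by
  classical
  have hle : Finsupp.single u 1 + Finsupp.single v 1 ≤ m := by
    intro w
    rw [Finsupp.add_apply, Finsupp.single_apply, Finsupp.single_apply]
    split_ifs with h1 h2 h2
    · exact absurd (h1.trans h2.symm) huv
    · subst h1; omega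
    · subst h2; omega
    · omega
  refine ⟨monomial (m - (Finsupp.single u 1 + Finsupp.single v 1)) a, ?_⟩
  rw [X, X, monomial_mul, monomial_mul, add_tsub_cancel_of_le hle, one_mul, one_mul]

/-- A monomial whose support is not a face is divisible by an edge or by a variable from `L`.
Quotients by initial variables of a regular sequence thus remain Stanley–Reisner rings. -/
theorem edgeIdeal_sup_ofList (G : SimpleGraph (Fin n)) (L : List (Fin n)) :
    edgeIdeal K G ⊔ Ideal.ofList (L.map X) = faceIdeal K (indepFaces G {v | v ∈ L}) := by
  apply le_antisymm
  · refine sup_le (Ideal.span_le.mpr ?_) (Ideal.span_le.mpr ?_)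
    · rintro _ ⟨i, j, hij, rfl⟩
      refine mem_faceIdeal.mpr fun F hF ↦ ?_
      rw [map_mul, faceMap_X, faceMap_X]
      by_cases hi : i ∈ F
      · rw [if_neg (fun hj ↦ hF.1 i hi j hj hij), mul_zero]
      · rw [if_neg hi, zero_mul]
    · intro x hx
      obtain ⟨v, hv, rfl⟩ := List.mem_map.mp hx
      refine mem_faceIdeal.mpr fun F hF ↦ ?_
      rw [faceMap_X, if_neg (fun h ↦ hF.2 v h hv)]
  · intro f hf
    rw [mem_faceIdeal] at hf
    rw [f.as_sum]
    refine Ideal.sum_mem _ fun m hm ↦ ?_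
    have hm' : m.support ∉ indepFaces G {v | v ∈ L} := by
      intro h
      have := congrArg (coeff m) (hf _ h)
      rw [coeff_faceMap, if_pos subset_rfl, coeff_zero] at this
      exact (mem_support_iff.mp hm) this
    by_cases h : ∃ v ∈ m.support, v ∈ L
    · obtain ⟨v, hv, hvL⟩ := h
      refine Submodule.mem_sup_right (Ideal.mem_of_dvd _ (X_dvd_monomial.mpr
        (Or.inr (Finsupp.mem_support_iff.mp hv))) (Ideal.subset_span ?_))
      exact List.mem_map_of_mem hvL
    · have : ∃ u ∈ m.support, ∃ v ∈ m.support, G.Adj u v := by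
        by_contra! hcon
        exact hm' ⟨hcon, fun u hu huL ↦ h ⟨u, hu, huL⟩⟩
      obtain ⟨u, hu, v, hv, huv⟩ := this
      refine Submodule.mem_sup_left (Ideal.mem_of_dvd _ (X_mul_X_dvd_monomial huv.ne
        (Finsupp.mem_support_iff.mp hu) (Finsupp.mem_support_iff.mp hv) _)
        (Ideal.subset_span ⟨u, v, huv, rfl⟩))

theorem edgeIdeal_eq_faceIdeal (G : SimpleGraph (Fin n)) :
    edgeIdeal K G = faceIdeal K (indepFaces G ∅) := by
  simpa using edgeIdeal_sup_ofList (K := K) G []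

theorem isWeaklyRegular_map_X (G : SimpleGraph (Fin n)) (L : List (Fin n)) (hL : L.Nodup)
    (hiso : ∀ v ∈ L, ∀ u, ¬ G.Adj v u) :
    IsWeaklyRegular (MvPolynomial (Fin n) K ⧸ edgeIdeal K G)
      (L.map (X : Fin n → MvPolynomial (Fin n) K)) := by
  induction L using List.reverseRecOn with
  | nil => simp
  | append_singleton L v ih =>
    rw [List.map_append, List.map_singleton]
    have hv : v ∉ L := fun h ↦ List.disjoint_of_nodup_append hL h (by simp)
    have hadj : ∀ u, ¬ G.Adj v u := hiso v (by simp)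
    refine (ih (List.Nodup.of_append_left hL) fun w hw ↦ hiso w (by simp [hw])).append_singleton
      fun f hf ↦ ?_
    rw [edgeIdeal_sup_ofList] at hf ⊢
    refine mem_faceIdeal_of_X_mul_mem (v := v) ?_ hf
    refine fun F hF ↦ ⟨?_, ?_⟩
    · intro a ha b hb hab
      rcases Finset.mem_insert.mp ha with rfl | ha'
      · exact hadj _ hab
      rcases Finset.mem_insert.mp hb with rfl | hb'
      · exact hadj _ hab.symm
      exact hF.1 a ha' b hb' hab
    · intro a ha
      rcases Finset.mem_insert.mp ha with rfl | ha'
      · exact hv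
      · exact hF.2 a ha'

theorem irrelevant_le_ker_constantCoeff :
    irrelevant K n ≤ RingHom.ker (constantCoeff : MvPolynomial (Fin n) K →+* K) := by
  refine Ideal.span_le.mpr ?_
  rintro _ ⟨i, rfl⟩
  simp [RingHom.mem_ker]

theorem edgeIdeal_le_irrelevant (G : SimpleGraph (Fin n)) :
    edgeIdeal K G ≤ irrelevant K n := by
  refine Ideal.span_le.mpr ?_
  rintro _ ⟨i, j, -, rfl⟩
  exact Ideal.mul_mem_right _ _ (Ideal.subset_span ⟨i, rfl⟩)

theorem irrelevant_ne_top : irrelevant K n ≠ ⊤ := fun h ↦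
  RingHom.ker_ne_top (constantCoeff : MvPolynomial (Fin n) K →+* K)
    (top_le_iff.mp (h ▸ irrelevant_le_ker_constantCoeff))

theorem length_le_depth (G : SimpleGraph (Fin n)) {rs : List (MvPolynomial (Fin n) K)}
    (hrs : IsWeaklyRegular (MvPolynomial (Fin n) K ⧸ edgeIdeal K G) rs)
    (hmem : ∀ x ∈ rs, x ∈ irrelevant K n) :
    (rs.length : ℕ∞) ≤ depth (irrelevant K n) (MvPolynomial (Fin n) K ⧸ edgeIdeal K G) :=
  le_sSup ⟨rs, hmem,
    hrs.isRegular_quotient (edgeIdeal_le_irrelevant G) hmem irrelevant_ne_top, rfl⟩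

/-- A maximal independent set is a facet; its prime is the annihilator of the product of its
variables, with quotient of dimension `F.card`. -/
theorem depth_le_card (G : SimpleGraph (Fin n)) {F : Finset (Fin n)}
    (hF : F ∈ indepFaces G ∅) (hmax : ∀ u ∉ F, ∃ v ∈ F, G.Adj u v) :
    depth (irrelevant K n) (MvPolynomial (Fin n) K ⧸ edgeIdeal K G) ≤ F.card := by
  refine sSup_le ?_
  rintro _ ⟨rs, hmem, hrs, rfl⟩
  have hmax' : ∀ F' ∈ indepFaces G ∅, F ⊆ F' → F' = F := by
    refine fun F' hF' hsub ↦ subset_antisymm (fun u hu ↦ ?_) hsub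
    by_contra huF
    obtain ⟨v, hv, huv⟩ := hmax u huF
    exact hF'.1 u hu v (hsub hv) huv
  have : (RingHom.ker (constantCoeff : MvPolynomial (Fin n) K →+* K)).IsPrime :=
    RingHom.ker_isPrime _
  have := isPrime_ker_faceMap (K := K) F
  have h := hrs.toIsWeaklyRegular.length_le_ringKrullDim_quotient
    (RingHom.ker (constantCoeff : MvPolynomial (Fin n) K →+* K)) rs
    (fun x hx ↦ irrelevant_le_ker_constantCoeff (hmem x hx)) (RingHom.ker (faceMap K F))
    (fun f hf ↦ by
      rw [RingHom.mem_ker] at hf ⊢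
      rw [← constantCoeff_faceMap F, hf, map_zero])
    (Submodule.Quotient.mk (∏ v ∈ F, X v)) (fun f ↦ by
      rw [← Submodule.Quotient.mk_smul, Submodule.Quotient.mk_eq_zero, edgeIdeal_eq_faceIdeal,
        smul_eq_mul, mul_prod_X_mem_faceIdeal_iff hF hmax', RingHom.mem_ker])
  rw [ringKrullDim_quotient_ker_faceMap] at h
  exact_mod_cast h

theorem sum_X_mem_irrelevant : ∑ v, X v ∈ irrelevant K n :=
  Ideal.sum_mem _ fun v _ ↦ Ideal.subset_span ⟨v, rfl⟩

theorem sumPairs_mem_irrelevant : sumPairs K (Fin n) ∈ irrelevant K n :=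
  Ideal.sum_mem _ fun p _ ↦ Ideal.mul_mem_right _ _ (Ideal.subset_span ⟨p.1, rfl⟩)

theorem isWeaklyRegular_append_sum_X (G : SimpleGraph (Fin n)) (L : List (Fin n)) (hL : L.Nodup)
    (hiso : ∀ v ∈ L, ∀ u, ¬ G.Adj v u) {v : Fin n} (hv : v ∉ L) :
    IsWeaklyRegular (MvPolynomial (Fin n) K ⧸ edgeIdeal K G)
      (L.map (X : Fin n → MvPolynomial (Fin n) K) ++ [∑ v, X v]) := by
  refine (isWeaklyRegular_map_X G L hL hiso).append_singleton fun f hf ↦ ?_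
  rw [edgeIdeal_sup_ofList] at hf ⊢
  refine mem_faceIdeal_of_sum_X_mul_mem (fun F hF ↦ ?_) hf
  rcases F.eq_empty_or_nonempty with rfl | hne
  · refine ⟨{v}, ⟨?_, ?_⟩, by simp, by simp⟩
    · simp
    · simpa using hv
  · exact ⟨F, hF, subset_rfl, hne⟩

/-- The depth of the edge ideal of a graph with set `A` of isolated vertices and a vertex adjacent
to all other vertices outside `A`. -/
theorem depth_of_dominating_vertex (G : SimpleGraph (Fin n)) (A : Finset (Fin n))
    (hA : ∀ v ∈ A, ∀ u, ¬ G.Adj v u) {v : Fin n} (hv : v ∉ A)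
    (hdom : ∀ u ∉ A, u ≠ v → G.Adj u v) :
    depth (irrelevant K n) (MvPolynomial (Fin n) K ⧸ edgeIdeal K G) = (A.card + 1 : ℕ) := by
  apply le_antisymm
  · rw [← Finset.card_insert_of_notMem hv]
    refine depth_le_card G ⟨?_, by simp⟩ ?_
    · intro a ha b hb hab
      rcases Finset.mem_insert.mp ha with rfl | ha'
      · rcases Finset.mem_insert.mp hb with rfl | hb'
        · exact hab.ne rfl
        · exact hA b hb' _ hab.symm
      · exact hA a ha' _ hab
    · intro u hu
      rw [Finset.mem_insert, not_or] at hu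
      exact ⟨v, Finset.mem_insert_self _ _, hdom u hu.2 hu.1⟩
  · refine le_trans (le_of_eq ?_) (length_le_depth G (isWeaklyRegular_append_sum_X G A.toList
      A.nodup_toList (by simpa using hA) (by simpa using hv)) ?_)
    · simp
    · intro x hx
      rcases List.mem_append.mp hx with hx | hx
      · obtain ⟨w, -, rfl⟩ := List.mem_map.mp hx
        exact Ideal.subset_span ⟨w, rfl⟩
      · rw [List.mem_singleton.mp hx]
        exact sum_X_mem_irrelevant

/-- The depth of the edge ideal of a graph with set `A` of isolated vertices, whose complement is
connected on the vertices outside `A` and has an edge that is a maximal clique there. -/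
theorem depth_of_dominating_pair (G : SimpleGraph (Fin n)) (A : Finset (Fin n))
    (hA : ∀ v ∈ A, ∀ u, ¬ G.Adj v u) {v w : Fin n} (hv : v ∉ A) (hw : w ∉ A) (hvw : v ≠ w)
    (hvw' : ¬ G.Adj v w) (hdom : ∀ u ∉ A, u ≠ v → u ≠ w → G.Adj u v ∨ G.Adj u w)
    (hpair : ∀ u ∉ A, ∃ u' ∉ A, u ≠ u' ∧ ¬ G.Adj u u')
    (hconn : ∀ c : Fin n → K, (∀ a ∉ A, ∀ b ∉ A, ¬ G.Adj a b → c a = c b) →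
      ∀ a ∉ A, ∀ b ∉ A, c a = c b) :
    depth (irrelevant K n) (MvPolynomial (Fin n) K ⧸ edgeIdeal K G) = (A.card + 2 : ℕ) := by
  have hvw'' : v ∉ insert w A := by simp [hv, hvw]
  have hface : ∀ (B : Set (Fin n)) (a b : Fin n), a ∉ B → b ∉ B → ¬ G.Adj a b →
      {a, b} ∈ indepFaces G B := by
    refine fun B a b ha hb hab ↦ ⟨?_, by simp [ha, hb]⟩
    simp [hab, G.adj_comm b a]
  apply le_antisymm
  · rw [show A.card + 2 = (insert v (insert w A)).card by
      rw [Finset.card_insert_of_notMem hvw'', Finset.card_insert_of_notMem hw]]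
    refine depth_le_card G ⟨?_, by simp⟩ ?_
    · intro a ha b hb hab
      have ha' : a ∉ A := fun h ↦ hA a h _ hab
      have hb' : b ∉ A := fun h ↦ hA b h _ hab.symm
      have := (hface ∅ v w (by simp) (by simp) hvw').1 a (by simpa [ha'] using ha) b
        (by simpa [hb'] using hb)
      exact this hab
    · intro u hu
      simp only [Finset.mem_insert, not_or] at hu
      rcases hdom u hu.2.2 hu.1 hu.2.1 with h | h
      · exact ⟨v, by simp, h⟩
      · exact ⟨w, by simp, h⟩
  · have hreg := (isWeaklyRegular_append_sum_X (K := K) G A.toList A.nodup_toList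
      (by simpa using hA) (by simpa using hv)).append_singleton (r := sumPairs K (Fin n)) (by
        intro f hf
        rw [Ideal.ofList_append, Ideal.ofList_singleton, ← sup_assoc, edgeIdeal_sup_ofList]
          at hf ⊢
        refine mem_sup_span_of_sumPairs_mul_mem (fun F hF F' h ↦ indepFaces_mono G _ hF h)
          ?_ ?_ hf
        · intro F hF
          rcases F.eq_empty_or_nonempty with rfl | ⟨u, hu⟩
          · exact ⟨{v, w}, hface _ v w (by simpa using hv) (by simpa using hw) hvw', by simp,
              by rw [Finset.card_pair hvw]; norm_num⟩
          · by_cases hcard : 1 < F.card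
            · exact ⟨F, hF, subset_rfl, hcard⟩
            · have huA : u ∉ A := by simpa using hF.2 u hu
              obtain ⟨u', hu', hne, hadj⟩ := hpair u huA
              refine ⟨{u, u'}, hface _ u u' (by simpa using huA) (by simpa using hu') hadj,
                fun x hx ↦ ?_, by rw [Finset.card_pair hne]; norm_num⟩
              rw [Finset.card_le_one.mp (not_lt.mp hcard) x hx u hu]
              simp
        · intro c hc a b ha hb
          refine hconn c (fun a ha b hb hab ↦ hc a b
            (hface _ a b (by simpa using ha) (by simpa using hb) hab)) a ?_ b ?_
          · simpa using ha.2 a (by simp)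
          · simpa using hb.2 b (by simp))
    refine le_trans (le_of_eq ?_) (length_le_depth G hreg ?_)
    · simp [one_add_one_eq_two]
    · intro x hx
      rcases List.mem_append.mp hx with hx | hx
      · rcases List.mem_append.mp hx with hx | hx
        · obtain ⟨w, -, rfl⟩ := List.mem_map.mp hx
          exact Ideal.subset_span ⟨w, rfl⟩
        · rw [List.mem_singleton.mp hx]
          exact sum_X_mem_irrelevant
      · rw [List.mem_singleton.mp hx]
        exact sumPairs_mem_irrelevant

end Depth

end IncChain

/-! ### Increasing maps, gaps of edges and stabilization -/

namespace IncChain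

open MvPolynomial

section Chain

variable {K : Type*} [Field K]

theorem monomial_mem_edgeIdeal_iff {n : ℕ} (G : SimpleGraph (Fin n)) (a : Fin n →₀ ℕ) :
    monomial a (1 : K) ∈ edgeIdeal K G ↔ ∃ u v, G.Adj u v ∧ a u ≠ 0 ∧ a v ≠ 0 := by
  constructor
  · rw [edgeIdeal_eq_faceIdeal, mem_faceIdeal]
    intro h
    by_contra! hcon
    have := h a.support ⟨fun u hu v hv huv ↦ Finsupp.mem_support_iff.mp hv
      (hcon u v huv (Finsupp.mem_support_iff.mp hu)), by simp⟩
    rw [faceMap_monomial, if_pos subset_rfl, monomial_eq_zero] at this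
    exact one_ne_zero this
  · rintro ⟨u, v, huv, hu, hv⟩
    exact Ideal.mem_of_dvd _ (X_mul_X_dvd_monomial huv.ne hu hv 1)
      (Ideal.subset_span ⟨u, v, huv, rfl⟩)

theorem X_mul_X_mem_edgeIdeal_iff {n : ℕ} (G : SimpleGraph (Fin n)) {i j : Fin n} :
    (X i * X j : MvPolynomial (Fin n) K) ∈ edgeIdeal K G ↔ G.Adj i j := by
  refine ⟨fun h ↦ ?_, fun h ↦ Ideal.subset_span ⟨i, j, h, rfl⟩⟩
  rw [X, X, monomial_mul, one_mul, monomial_mem_edgeIdeal_iff] at h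
  obtain ⟨u, v, huv, hu, hv⟩ := h
  have key : ∀ w, (Finsupp.single i 1 + Finsupp.single j 1 : Fin n →₀ ℕ) w ≠ 0 →
      w = i ∨ w = j := by
    intro w hw
    by_contra! hcon
    exact hw (by simp [hcon.1.symm, hcon.2.symm])
  rcases key u hu with rfl | rfl <;> rcases key v hv with rfl | rfl
  · exact absurd rfl huv.ne
  · exact huv
  · exact huv.symm
  · exact absurd rfl huv.ne

theorem edgeIdeal_ne_bot {n : ℕ} {G : SimpleGraph (Fin n)} (h : edgeIdeal K G ≠ ⊥) :
    ∃ i j, G.Adj i j := by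
  by_contra! hcon
  refine h (Ideal.span_eq_bot.mpr ?_)
  rintro _ ⟨i, j, hij, -⟩
  exact absurd hij (hcon i j)

theorem act_X_mul_X {m n : ℕ} {π : ℕ → ℕ} (hπ : π ∈ Inc m n) (i j : Fin m) :
    act K hπ (X i * X j) = X ⟨π i, hπ.2 i i.isLt⟩ * X ⟨π j, hπ.2 j j.isLt⟩ := by
  simp [act]

theorem incSpan_edgeIdeal_le {m n : ℕ} (G : SimpleGraph (Fin m)) (G' : SimpleGraph (Fin n))
    (h : ∀ (π : ℕ → ℕ) (hπ : π ∈ Inc m n) (i j : Fin m), G.Adj i j →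
      G'.Adj ⟨π i, hπ.2 i i.isLt⟩ ⟨π j, hπ.2 j j.isLt⟩) :
    incSpan (edgeIdeal K G) n ≤ edgeIdeal K G' := by
  refine Ideal.span_le.mpr ?_
  rintro _ ⟨π, hπ, f, hf, rfl⟩
  have hle : edgeIdeal K G ≤ (edgeIdeal K G').comap (act K hπ) := by
    refine Ideal.span_le.mpr ?_
    rintro _ ⟨i, j, hij, rfl⟩
    rw [SetLike.mem_coe, Ideal.mem_comap, act_X_mul_X]
    exact Ideal.subset_span ⟨_, _, h π hπ i j hij, rfl⟩
  exact hle hf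

/-- The graph generated by the images of a graph under the increasing maps. -/
def incGraph {m : ℕ} (G : SimpleGraph (Fin m)) (n : ℕ) : SimpleGraph (Fin n) where
  Adj a b := ∃ π ∈ Inc m n, ∃ i j : Fin m, G.Adj i j ∧ π i = a ∧ π j = b
  symm := ⟨fun _ _ ⟨π, hπ, i, j, hij, ha, hb⟩ ↦ ⟨π, hπ, j, i, hij.symm, hb, ha⟩⟩
  loopless := ⟨fun _ ⟨_, hπ, _, _, hij, ha, hb⟩ ↦
    hij.ne (Fin.ext (hπ.1.injective (ha.trans hb.symm)))⟩

theorem incSpan_edgeIdeal {m : ℕ} (G : SimpleGraph (Fin m)) (n : ℕ) :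
    incSpan (edgeIdeal K G) n = edgeIdeal K (incGraph G n) := by
  apply le_antisymm
  · exact incSpan_edgeIdeal_le _ _ fun π hπ i j hij ↦ ⟨π, hπ, i, j, hij, rfl, rfl⟩
  · refine Ideal.span_le.mpr ?_
    rintro _ ⟨a, b, ⟨π, hπ, i, j, hij, ha, hb⟩, rfl⟩
    refine Ideal.subset_span ⟨π, hπ, X i * X j, Ideal.subset_span ⟨i, j, hij, rfl⟩, ?_⟩
    rw [act_X_mul_X]
    congr 2 <;> exact Fin.ext (by simp [ha, hb])

theorem edgeIdeal_le_edgeIdeal_iff {n : ℕ} {G G' : SimpleGraph (Fin n)} :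
    edgeIdeal K G ≤ edgeIdeal K G' ↔ G ≤ G' := by
  refine ⟨fun h a b hab ↦ ?_, fun h ↦ Ideal.span_mono ?_⟩
  · exact (X_mul_X_mem_edgeIdeal_iff (K := K) G').mp (h (Ideal.subset_span ⟨a, b, hab, rfl⟩))
  · rintro _ ⟨i, j, hij, rfl⟩
    exact ⟨i, j, h hij, rfl⟩

theorem exists_mem_Inc {m n i j a b : ℕ} (hij : i < j) (hj : j < m) (hia : i ≤ a)
    (hd : j + a ≤ b + i) (hb : b + m ≤ n + j) : ∃ π ∈ Inc m n, π i = a ∧ π j = b := by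
  -- The identity below `i`, then a shift by `a - i`, then from `j` on a shift by `b - j`.
  refine ⟨fun k ↦ if k < i then k else if k < j then k - i + a else k - j + b,
    ⟨fun k l hkl ↦ ?_, fun k hk ↦ ?_⟩, ?_, ?_⟩
  · dsimp only
    split_ifs <;> omega
  · dsimp only
    split_ifs <;> omega
  · simp [hij]
  · simp [hij.not_gt]

theorem Inc_bounds {m n i j : ℕ} {π : ℕ → ℕ} (hπ : π ∈ Inc m n) (hij : i < j) (hj : j < m) :
    i ≤ π i ∧ j + π i ≤ π j + i ∧ π j + m ≤ n + j := by
  have hadd : ∀ x k, π x + k ≤ π (x + k) := by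
    intro x k
    induction k with
    | zero => simp
    | succ k ih => exact Nat.succ_le_of_lt (ih.trans_lt (hπ.1 (Nat.lt_succ_self _)))
  refine ⟨hπ.1.id_le i, ?_, ?_⟩
  · have := hadd i (j - i)
    rw [Nat.add_sub_cancel' hij.le] at this
    omega
  · have h1 := hadd j (m - 1 - j)
    have h2 := hπ.2 (m - 1) (by omega)
    rw [show j + (m - 1 - j) = m - 1 by omega] at h1
    omega

/-- The pair `{a, b}` with `a < b` is an edge of the graph on `n` vertices. -/
def IsEdge {n : ℕ} (G : SimpleGraph (Fin n)) (a b : ℕ) : Prop :=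
  a < b ∧ ∃ (ha : a < n) (hb : b < n), G.Adj ⟨a, ha⟩ ⟨b, hb⟩

theorem adj_iff_isEdge {n : ℕ} {G : SimpleGraph (Fin n)} {a b : Fin n} (hab : a < b) :
    G.Adj a b ↔ IsEdge G a b :=
  ⟨fun h ↦ ⟨hab, a.2, b.2, h⟩, fun ⟨_, _, _, h⟩ ↦ h⟩

/-- An increasing map can enlarge independently, but never shrink, the gaps before, between and
after the two endpoints. -/
theorem isEdge_incGraph_iff {m : ℕ} (G : SimpleGraph (Fin m)) {n a b : ℕ} :
    IsEdge (incGraph G n) a b ↔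
      ∃ i j, IsEdge G i j ∧ i ≤ a ∧ j + a ≤ b + i ∧ b + m ≤ n + j := by
  constructor
  · rintro ⟨hab, ha, hb, π, hπ, i, j, hij, rfl, rfl⟩
    have hlt : i < j := hπ.1.lt_iff_lt.mp hab
    exact ⟨i, j, ⟨hlt, i.2, j.2, hij⟩, Inc_bounds hπ hlt j.2⟩
  · rintro ⟨i, j, ⟨hij, hi, hj, hadj⟩, h1, h2, h3⟩
    obtain ⟨π, hπ, rfl, rfl⟩ := exists_mem_Inc hij hj h1 h2 h3
    exact ⟨hπ.1 hij, hπ.2 i hi, hπ.2 j hj, π, hπ, _, _, hadj, rfl, rfl⟩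

theorem le_iff_isEdge {n : ℕ} {G G' : SimpleGraph (Fin n)} :
    G ≤ G' ↔ ∀ a b, IsEdge G a b → IsEdge G' a b := by
  refine ⟨fun h a b ⟨hab, ha, hb, hadj⟩ ↦ ⟨hab, ha, hb, h hadj⟩, fun h a b hab ↦ ?_⟩
  rcases lt_or_gt_of_ne hab.ne with hlt | hlt
  · exact (adj_iff_isEdge hlt).mpr (h _ _ ((adj_iff_isEdge hlt).mp hab))
  · exact ((adj_iff_isEdge hlt).mpr (h _ _ ((adj_iff_isEdge hlt).mp hab.symm))).symm

/-- An invariant chain of edge ideals stabilizes. -/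
theorem exists_incGraph_eq (G : (n : ℕ) → SimpleGraph (Fin n))
    (hinv : ∀ m n : ℕ, 1 ≤ m → m ≤ n → incGraph (G m) n ≤ G n) :
    ∃ r, 1 ≤ r ∧ ∀ m n : ℕ, r ≤ m → m ≤ n → incGraph (G m) n = G n := by
  -- An edge at any level is coded by its three gaps, which sum to the level minus one. By Dickson's
  -- lemma only finitely many codes are minimal, and `N` bounds their levels.
  let S : ℕ × ℕ × ℕ → Prop := fun x ↦ IsEdge (G (x.1 + x.2.1 + x.2.2 + 1)) x.1 (x.1 + x.2.1)
  have hup : ∀ m i j n a b, 1 ≤ m → m ≤ n → IsEdge (G m) i j → i ≤ a → j + a ≤ b + i →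
      b + m ≤ n + j → IsEdge (G n) a b := fun m i j n a b hm hmn hij h1 h2 h3 ↦
    le_iff_isEdge.mp (hinv m n hm hmn) a b ((isEdge_incGraph_iff _).mpr ⟨i, j, hij, h1, h2, h3⟩)
  have hfin : {x | Minimal S x}.Finite :=
    WellQuasiOrderedLE.finite_of_isAntichain (setOfPred_minimal_antichain S)
  obtain ⟨N, hN⟩ := (hfin.image fun x : ℕ × ℕ × ℕ ↦ x.1 + x.2.1 + x.2.2 + 1).bddAbove
  refine ⟨N + 1, by omega, fun m n hm hmn ↦ le_antisymm (hinv m n (by omega) hmn) ?_⟩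
  rw [le_iff_isEdge]
  intro a b hab
  have hlt : a < b := hab.1
  have hbn : b < n := hab.2.2.1
  have hS : S (a, b - a, n - 1 - b) := by
    simp only [S]
    rw [show a + (b - a) + (n - 1 - b) + 1 = n by omega, show a + (b - a) = b by omega]
    exact hab
  obtain ⟨⟨a₀, d₀, c₀⟩, hle, hmin⟩ := exists_minimal_le_of_wellFoundedLT S _ hS
  have hN' : a₀ + d₀ + c₀ + 1 ≤ N := hN ⟨_, hmin, rfl⟩
  simp only [Prod.mk_le_mk] at hle
  obtain ⟨h1, h2, h3⟩ := hle
  have hedge : IsEdge (G (a₀ + d₀ + c₀ + 1)) a₀ (a₀ + d₀) := hmin.1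
  rw [isEdge_incGraph_iff]
  have hd₀ : 0 < d₀ := by
    have := hedge.1
    omega
  -- The sum `m - 1` lies between those of the minimal code and the given code, so filling the gaps
  -- greedily produces an intermediate edge at level `m`.
  obtain ⟨a₁, d₁, c₁, hs, ha₁, hd₁, hc₁, ha₁', hd₁', hc₁'⟩ : ∃ a₁ d₁ c₁, a₁ + d₁ + c₁ + 1 = m ∧
      a₀ ≤ a₁ ∧ d₀ ≤ d₁ ∧ c₀ ≤ c₁ ∧ a₁ ≤ a ∧ d₁ ≤ b - a ∧ c₁ ≤ n - 1 - b := by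
    refine ⟨min a (m - 1 - d₀ - c₀), min (b - a) (m - 1 - min a (m - 1 - d₀ - c₀) - c₀),
      m - 1 - min a (m - 1 - d₀ - c₀) -
        min (b - a) (m - 1 - min a (m - 1 - d₀ - c₀) - c₀), ?_⟩
    omega
  refine ⟨a₁, a₁ + d₁, hup _ _ _ m _ _ (by omega) (by omega) hedge ha₁ (by omega) (by omega),
    ha₁', by omega, by omega⟩

theorem supportIndices_edgeIdeal {n : ℕ} (G : SimpleGraph (Fin n)) :
    supportIndices (edgeIdeal K G) = {k | ∃ i j : Fin n, k = (i : ℕ) + 1 ∧ G.Adj i j} := by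
  ext k
  constructor
  · rintro ⟨i, rfl, a, ha, hai⟩
    obtain ⟨u, v, huv, hu, hv⟩ := (monomial_mem_edgeIdeal_iff G a).mp ha.1
    have hle : Finsupp.single u 1 + Finsupp.single v 1 ≤ a := by
      have := X_mul_X_dvd_monomial (K := K) huv.ne hu hv 1
      rw [X, X, monomial_mul, one_mul, monomial_dvd_monomial] at this
      exact this.1.resolve_left one_ne_zero
    have hle' := ha.2 ((monomial_mem_edgeIdeal_iff G _).mpr ⟨u, v, huv, by simp, by simp⟩) hle i
    have hi : u = i ∨ v = i := by
      by_contra! hcon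
      rw [Finsupp.add_apply, Finsupp.single_eq_of_ne' hcon.1, Finsupp.single_eq_of_ne' hcon.2]
        at hle'
      omega
    rcases hi with rfl | rfl
    · exact ⟨u, v, rfl, huv⟩
    · exact ⟨v, u, rfl, huv.symm⟩
  · rintro ⟨i, j, rfl, hij⟩
    refine ⟨i, rfl, Finsupp.single i 1 + Finsupp.single j 1,
      ⟨(monomial_mem_edgeIdeal_iff G _).mpr ⟨i, j, hij, by simp, by simp⟩, fun b hb hle ↦ ?_⟩,
      by simp⟩
    obtain ⟨u, v, huv, hu, hv⟩ := (monomial_mem_edgeIdeal_iff G b).mp hb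
    have key : ∀ w, b w ≠ 0 → w = i ∨ w = j := by
      intro w hw
      by_contra! hcon
      have := hle w
      rw [Finsupp.add_apply, Finsupp.single_eq_of_ne hcon.1, Finsupp.single_eq_of_ne hcon.2]
        at this
      omega
    have hdvd : b i ≠ 0 ∧ b j ≠ 0 := by
      rcases key u hu with rfl | rfl <;> rcases key v hv with rfl | rfl
      · exact absurd rfl huv.ne
      · exact ⟨hu, hv⟩
      · exact ⟨hv, hu⟩
      · exact absurd rfl huv.ne
    have := X_mul_X_dvd_monomial (K := K) hij.ne hdvd.1 hdvd.2 1
    rw [X, X, monomial_mul, one_mul, monomial_dvd_monomial] at this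
    exact this.1.resolve_left one_ne_zero

end Chain

end IncChain

/-! ### Depth of the generated graphs -/

namespace IncChain

open MvPolynomial

theorem card_filter_outside_interval {n s q : ℕ} (hs : s ≤ q) (hq : q < n) :
    (Finset.univ.filter fun u : Fin n ↦ (u : ℕ) < s ∨ q < u).card = s + (n - 1 - q) := by
  rw [← Finset.card_map Fin.valEmbedding, show (Finset.univ.filter fun u : Fin n ↦
      (u : ℕ) < s ∨ q < u).map Fin.valEmbedding = Finset.range s ∪ Finset.Ico (q + 1) n by
    ext x
    simp only [Finset.mem_map, Finset.mem_filter, Finset.mem_univ, true_and, Fin.valEmbedding_apply,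
      Finset.mem_union, Finset.mem_range, Finset.mem_Ico]
    constructor
    · rintro ⟨u, hu, rfl⟩
      omega
    · intro h
      exact ⟨⟨x, by omega⟩, by simp only; omega, rfl⟩,
    Finset.card_union_of_disjoint, Finset.card_range, Nat.card_Ico]
  · omega
  · rw [Finset.disjoint_left]
    intro x hx hx'
    simp only [Finset.mem_range, Finset.mem_Ico] at hx hx'
    omega

/-- The depth of the edge ideal of the graph generated by a graph whose sparsity is at most two. -/
theorem depth_incGraph {K : Type*} [Field K] {r n : ℕ} (H : SimpleGraph (Fin r))
    {s j₁ i₁ e i₀ j₀ : ℕ} (hs : IsEdge H s j₁) (hsmin : ∀ i j, IsEdge H i j → s ≤ i)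
    (he : IsEdge H i₁ e) (hemax : ∀ i j, IsEdge H i j → j ≤ e) (h₀ : IsEdge H i₀ j₀)
    (hmin : ∀ i j, IsEdge H i j → j₀ - i₀ ≤ j - i) (hle : j₀ - i₀ ≤ 2)
    (hn : r + 2 * (e - s + 1) ≤ n) :
    depth (irrelevant K n) (MvPolynomial (Fin n) K ⧸ edgeIdeal K (incGraph H n)) =
      ((r - (e - s + 1) + (j₀ - i₀) : ℕ) : ℕ∞) := by
  have hs₀ := hsmin _ _ h₀
  have he₀ := hemax _ _ h₀
  have hs₁ := hsmin _ _ he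
  have he₁ := hemax _ _ hs
  have her : e < r := he.2.2.1
  have hlt₀ := h₀.1
  have hlts := hs.1
  have hlte := he.1
  set A : Finset (Fin n) := Finset.univ.filter fun u : Fin n ↦ (u : ℕ) < s ∨ n + e - r < u with hAdef
  have hcard : A.card = r - (e - s + 1) := by
    rw [hAdef, card_filter_outside_interval (by omega) (by omega)]
    omega
  have hmemA : ∀ u : Fin n, u ∉ A ↔ s ≤ u ∧ (u : ℕ) + r ≤ n + e := by
    intro u
    simp only [hAdef, Finset.mem_filter, Finset.mem_univ, true_and]
    omega
  have hedge : ∀ a b : Fin n, (a : ℕ) < b → ((incGraph H n).Adj a b ↔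
      ∃ i j, IsEdge H i j ∧ i ≤ a ∧ j + a ≤ b + i ∧ b + r ≤ n + j) := fun a b hab ↦
    (adj_iff_isEdge hab).trans (isEdge_incGraph_iff H)
  have hiso : ∀ v ∈ A, ∀ u, ¬ (incGraph H n).Adj v u := by
    intro v hv u hadj
    have hv' : ¬ (s ≤ v ∧ (v : ℕ) + r ≤ n + e) := fun h ↦ (hmemA v).mpr h hv
    rcases lt_or_gt_of_ne hadj.ne with hlt | hlt
    · obtain ⟨i, j, hij, h1, h2, h3⟩ := (hedge v u hlt).mp hadj
      have := hsmin _ _ hij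
      have := hemax _ _ hij
      have : (v : ℕ) < u := hlt
      omega
    · obtain ⟨i, j, hij, h1, h2, h3⟩ := (hedge u v hlt).mp hadj.symm
      have := hsmin _ _ hij
      have := hemax _ _ hij
      have : (u : ℕ) < v := hlt
      omega
  obtain hsp | hsp : j₀ - i₀ = 1 ∨ j₀ - i₀ = 2 := by omega
  · rw [hsp, ← hcard]
    -- Far enough right that the edge `(s, j₁)` reaches `v` from every `u < i₀` in the interval, and
    -- that `(i₁, e)` can start at `v`. The shortest edge `(i₀, j₀)` serves the other `u`. The bound
    -- on `n` leaves enough room to the right of `v`.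
    let v : Fin n := ⟨max (i₀ + (j₁ - s)) i₁, by omega⟩
    have hvval : (v : ℕ) = max (i₀ + (j₁ - s)) i₁ := rfl
    refine depth_of_dominating_vertex _ A hiso (v := v) ((hmemA v).mpr (by omega)) ?_
    intro u hu huv
    rw [hmemA] at hu
    rcases lt_or_gt_of_ne huv with hlt | hlt
    · rw [hedge u v hlt]
      have : (u : ℕ) < v := hlt
      by_cases hui : (u : ℕ) < i₀
      · exact ⟨s, j₁, hs, by omega⟩
      · exact ⟨i₀, j₀, h₀, by omega⟩
    · rw [SimpleGraph.adj_comm, hedge v u hlt]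
      have : (v : ℕ) < u := hlt
      by_cases hui : (u : ℕ) + r ≤ n + j₀
      · exact ⟨i₀, j₀, h₀, by omega⟩
      · exact ⟨i₁, e, he, by omega⟩
  · have hconsec : ∀ a b : Fin n, (b : ℕ) = a + 1 → ¬ (incGraph H n).Adj a b := by
      intro a b hab hadj
      obtain ⟨i, j, hij, h1, h2, h3⟩ := (hedge a b (by omega)).mp hadj
      have := hmin _ _ hij
      omega
    rw [hsp, ← hcard]
    let v : Fin n := ⟨max (i₀ + (j₁ - s)) i₁, by omega⟩
    have hvval : (v : ℕ) = max (i₀ + (j₁ - s)) i₁ := rfl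
    -- Vertices left of `v` are joined to `w` and those right of `w` to `v`, so the middle gap is
    -- always at least 2.
    let w : Fin n := ⟨v + 1, by omega⟩
    have hwval : (w : ℕ) = v + 1 := rfl
    refine depth_of_dominating_pair _ A hiso (v := v) (w := w) ((hmemA v).mpr (by omega))
      ((hmemA w).mpr (by omega)) (fun h ↦ by rw [← h] at hwval; omega) (hconsec v w hwval) ?_ ?_ ?_
    · intro u hu huv huw
      rw [hmemA] at hu
      have huv' : (u : ℕ) ≠ v := fun h ↦ huv (Fin.ext h)
      have huw' : (u : ℕ) ≠ w := fun h ↦ huw (Fin.ext h)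
      rcases lt_or_gt_of_ne huv' with hlt | hlt
      · right
        rw [hedge u w (by omega)]
        by_cases hui : (u : ℕ) < i₀
        · exact ⟨s, j₁, hs, by omega⟩
        · exact ⟨i₀, j₀, h₀, by omega⟩
      · left
        rw [SimpleGraph.adj_comm, hedge v u (by omega)]
        by_cases hui : (u : ℕ) + r ≤ n + j₀
        · exact ⟨i₀, j₀, h₀, by omega⟩
        · exact ⟨i₁, e, he, by omega⟩
    · intro u hu
      rw [hmemA] at hu
      by_cases hus : (u : ℕ) = s
      · let u' : Fin n := ⟨u + 1, by omega⟩
        have hu' : (u' : ℕ) = u + 1 := rfl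
        exact ⟨u', (hmemA u').mpr (by omega), fun h ↦ by rw [← h] at hu'; omega, hconsec u u' hu'⟩
      · let u' : Fin n := ⟨u - 1, by omega⟩
        have hu' : (u' : ℕ) = u - 1 := rfl
        exact ⟨u', (hmemA u').mpr (by omega), fun h ↦ by rw [← h] at hu'; omega,
          fun h ↦ hconsec u' u (by omega) h.symm⟩
    · intro c hc
      -- The non-edges between consecutive vertices form a path through the whole interval.
      have hstep : ∀ k (hk : s + k < n), s + k + r ≤ n + e →
          c ⟨s + k, hk⟩ = c ⟨s, by omega⟩ := by
        intro k
        induction k with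
        | zero => intros; rfl
        | succ k ih =>
          intro hk hkr
          rw [← ih (by omega) (by omega)]
          refine (hc _ ((hmemA _).mpr ?_) _ ((hmemA _).mpr ?_) (hconsec _ _ ?_)).symm <;>
            simp only <;> omega
      have hall : ∀ a ∉ A, c a = c ⟨s, by omega⟩ := by
        intro a ha
        rw [hmemA] at ha
        rw [← hstep (a - s) (by omega) (by omega)]
        congr 1
        exact Fin.ext (by simp only; omega)
      intro a ha b hb
      rw [hall a ha, hall b hb]

end IncChain

/-! ### Reading the invariants off the edges of `G_r` -/

theorem corollary4p4 {K : Type*} [Field K]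
    (I : (n : ℕ) → Ideal (MvPolynomial (Fin n) K))
    (G : (n : ℕ) → SimpleGraph (Fin n))
    (hG : ∀ n : ℕ, 1 ≤ n → I n = IncChain.edgeIdeal K (G n))
    (hinv : IncChain.IsInvariant I)
    (hne : ∃ N : ℕ, ∀ n : ℕ, N ≤ n → I n ≠ ⊥)
    (hsp : IncChain.sparsity (G (IncChain.stabilityIndex I)) ≤ 2)
    (n : ℕ) (hn : IncChain.stabilityIndex I + 2 * IncChain.rTilde I ≤ n) :
    IncChain.depth (IncChain.irrelevant K n) (MvPolynomial (Fin n) K ⧸ I n) =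
      ((IncChain.stabilityIndex I - IncChain.rTilde I
        + IncChain.sparsity (G (IncChain.stabilityIndex I)) : ℕ) : ℕ∞) := by
  open IncChain in
  have hincl : ∀ m n, 1 ≤ m → incSpan (I m) n = edgeIdeal K (incGraph (G m) n) :=
    fun m n hm ↦ by rw [hG m hm, incSpan_edgeIdeal]
  obtain ⟨r₀, hr₀, hstab₀⟩ := exists_incGraph_eq G fun m n hm hmn ↦ by
    have := hinv m n hm hmn
    rwa [hincl m n hm, hG n (hm.trans hmn), edgeIdeal_le_edgeIdeal_iff] at this
  -- Stabilization makes the defining set nonempty, so its infimum is attained and is not the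
  -- default value 0.
  obtain ⟨hr1, hstab⟩ : 1 ≤ stabilityIndex I ∧ ∀ m n : ℕ, stabilityIndex I ≤ m → m ≤ n →
      incSpan (I m) n = I n :=
    Nat.sInf_mem (s := {r | 1 ≤ r ∧ ∀ m n : ℕ, r ≤ m → m ≤ n → incSpan (I m) n = I n})
      ⟨r₀, hr₀, fun m n hm hmn ↦ by
        rw [hincl m n (by omega), hstab₀ m n hm hmn, hG n (by omega)]⟩
  have hrt : rTilde I =
    maxSupp (I (stabilityIndex I)) - minSupp (I (stabilityIndex I)) + 1 := rfl
  generalize stabilityIndex I = r at *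
  have hIn : ∀ n, r ≤ n → I n = edgeIdeal K (incGraph (G r) n) := fun n hrn ↦ by
    rw [← hstab r n le_rfl hrn, hincl r n hr1]
  obtain ⟨x, y, hxy⟩ : ∃ x y, IsEdge (G r) x y := by
    obtain ⟨N, hN⟩ := hne
    have h1 := hN (max N r) (le_max_left _ _)
    rw [hIn _ (le_max_right _ _)] at h1
    obtain ⟨a, b, π, hπ, i, j, hij, -, -⟩ := edgeIdeal_ne_bot h1
    rcases lt_or_gt_of_ne hij.ne with hlt | hlt
    · exact ⟨i, j, (adj_iff_isEdge hlt).mp hij⟩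
    · exact ⟨j, i, (adj_iff_isEdge hlt).mp hij.symm⟩
  have hsupp : supportIndices (I r) = {k | ∃ i j : Fin r, k = (i : ℕ) + 1 ∧ (G r).Adj i j} := by
    rw [hG r hr1, supportIndices_edgeIdeal]
  have hleft : ∀ {i j}, IsEdge (G r) i j → i + 1 ∈ supportIndices (I r) := by
    rintro i j ⟨-, hi, hj, hij⟩
    rw [hsupp]
    exact ⟨⟨i, hi⟩, ⟨j, hj⟩, rfl, hij⟩
  have hright : ∀ {i j}, IsEdge (G r) i j → j + 1 ∈ supportIndices (I r) := by
    rintro i j ⟨-, hi, hj, hij⟩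
    rw [hsupp]
    exact ⟨⟨j, hj⟩, ⟨i, hi⟩, rfl, hij.symm⟩
  have hbdd : BddAbove (supportIndices (I r)) := by
    refine ⟨r, ?_⟩
    rw [hsupp]
    rintro _ ⟨i, j, rfl, -⟩
    omega
  obtain ⟨s, j₁, hs, hsmin⟩ : ∃ s j₁, IsEdge (G r) s j₁ ∧ minSupp (I r) = s + 1 := by
    have hmem : minSupp (I r) ∈ supportIndices (I r) := Nat.sInf_mem ⟨_, hleft hxy⟩
    have hmem' := hmem
    rw [hsupp] at hmem'
    obtain ⟨i, j, hi, hij⟩ := hmem'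
    rcases lt_or_gt_of_ne hij.ne with hlt | hlt
    · exact ⟨i, j, (adj_iff_isEdge hlt).mp hij, hi⟩
    · have h1 : minSupp (I r) ≤ _ := Nat.sInf_le (hleft ((adj_iff_isEdge hlt).mp hij.symm))
      have h2 : (j : ℕ) < i := hlt
      omega
  obtain ⟨i₁, e, he, hemax⟩ : ∃ i₁ e, IsEdge (G r) i₁ e ∧ maxSupp (I r) = e + 1 := by
    have hmem : maxSupp (I r) ∈ supportIndices (I r) := Nat.sSup_mem ⟨_, hleft hxy⟩ hbdd
    have hmem' := hmem
    rw [hsupp] at hmem'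
    obtain ⟨i, j, hi, hij⟩ := hmem'
    rcases lt_or_gt_of_ne hij.ne with hlt | hlt
    · have h1 : _ ≤ maxSupp (I r) := le_csSup hbdd (hright ((adj_iff_isEdge hlt).mp hij))
      have h2 : (i : ℕ) < j := hlt
      omega
    · exact ⟨j, i, (adj_iff_isEdge hlt).mp hij.symm, hi⟩
  obtain ⟨i₀, j₀, h₀, hsp₀⟩ : ∃ i₀ j₀, IsEdge (G r) i₀ j₀ ∧ sparsity (G r) = j₀ - i₀ := by
    obtain ⟨hlt, hx, hy, hadj⟩ := hxy
    obtain ⟨i, j, hij, hadj, hd⟩ := Nat.sInf_mem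
      (s := {d | ∃ i j : Fin r, i < j ∧ (G r).Adj i j ∧ d = (j : ℕ) - (i : ℕ)})
      ⟨_, ⟨x, hx⟩, ⟨y, hy⟩, hlt, hadj, rfl⟩
    exact ⟨i, j, (adj_iff_isEdge hij).mp hadj, hd⟩
  -- The shifts from 1-based support indices to 0-based vertices cancel.
  have hrt' : rTilde I = e - s + 1 := by omega
  rw [hrt'] at hn ⊢
  rw [hsp₀] at hsp ⊢
  rw [hIn n (by omega)]
  refine depth_incGraph (G r) hs (fun i j hij ↦ ?_) he (fun i j hij ↦ ?_) h₀ (fun i j hij ↦ ?_)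
    hsp hn
  · have h1 : minSupp (I r) ≤ _ := Nat.sInf_le (hleft hij)
    omega
  · have h1 : _ ≤ maxSupp (I r) := le_csSup hbdd (hright hij)
    omega
  · obtain ⟨hlt, hi, hj, hadj⟩ := hij
    rw [← hsp₀]
    exact Nat.sInf_le ⟨⟨i, hi⟩, ⟨j, hj⟩, hlt, hadj, rfl⟩
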